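/- For a normed complex vector space $E$, let $\mathcal G_E=\mathcal M_E/\mathcal N_E$, where $\mathcal M_E$ is the set of nets $(u_\varepsilon)_\varepsilon\in E^{(0,1)}$ such that for some $N\in\mathbb N$, $\|u_\varepsilon\|\le\varepsilon^{-N}$ for all sufficiently small $\varepsilon$, and $\mathcal N_E$ is the set of nets such that for every $m\in\mathbb N$, $\|u_\varepsilon\|\le\varepsilon^{m}$ for all sufficiently small $\varepsilon$. Write $[(u_\varepsilon)_\varepsilon]$ for the class of $(u_\varepsilon)_\varepsilon$. Let $\widetilde{\mathbb C}=\mathcal G_{\mathbb C}$. With componentwise operations $\widetilde{\mathbb C}$ is a commutative ring and $\mathcal G_E$ is a $\widetilde{\mathbb C}$-module. Put $\mathcal P([(u_\varepsilon)_\varepsilon])=e^{-v}$ with $v=\sup\{b\in\mathbb R:\|u_\varepsilon\|\le\varepsilon^{b}\text{ for small }\varepsilon\}$ and $e^{-\infty}=0$; for $E=\mathbb C$ write $|\cdot|_e$ for $\mathcal P$. If $B$ is a unital C*-algebra, $\mathcal G_B$ is a unital $\widetilde{\mathbb C}$-algebra with involution, with componentwise product and involution. A *Colombeau C\*-algebra*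 is a unital associative $\widetilde{\mathbb C}$-algebra $\mathcal A$ with a map $u\mapsto u^*$ satisfying $u^{**}=u$, $(u+w)^*=u^*+w^*$, $(\lambda u)^*=\bar\lambda u^*$, $(uw)^*=w^*u^*$, and with a map $\mathcal P:\mathcal A\to[0,\infty)$ such that $\mathcal P(u)=0$ iff $u=0$, $\mathcal P(u+w)\le\max(\mathcal P(u),\mathcal P(w))$, $\mathcal P(\lambda u)\le|\lambda|_e\,\mathcal P(u)$, $\mathcal P(uw)\le\mathcal P(u)\mathcal P(w)$, $\mathcal P(1)=1$, $\mathcal P(u^*u)=\mathcal P(u)^2$ for all $u,w\in\mathcal A$, $\lambda\in\widetilde{\mathbb C}$, and such that $\mathcal A$ is complete for the metric $\mathcal P(u-w)$. A *Colombeau C\*-subalgebra* of a $\widetilde{\mathbb C}$-algebra with involution and submultiplicative norm $\mathcal P$ is a $\widetilde{\mathbb C}$-subalgebra that contains $1$, is closed under $*$, and is a Colombeau C*-algebra for the inherited structure. An *isomorphism of Colombeau C\*-algebras* is a bijective $\widetilde{\mathbb C}$-linear multiplicative map that preserves $*$ and $\mathcal P$. For a complex Hilbert space $H$, let $L(H)$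 be the C*-algebra of bounded operators on $H$, and let $\mathcal B(\mathcal G_H)$ be the algebra of continuous $\widetilde{\mathbb C}$-linear maps $T:\mathcal G_H\to\mathcal G_H$ that have an adjoint for the inner product $\langle[(u_\varepsilon)_\varepsilon],[(w_\varepsilon)_\varepsilon]\rangle=[(\langle u_\varepsilon,w_\varepsilon\rangle)_\varepsilon]\in\widetilde{\mathbb C}$, with the adjoint as involution and with the operator norm $\mathcal P(T)=\inf\{C\ge0:\mathcal P(Tu)\le C\,\mathcal P(u)\ \forall u\in\mathcal G_H\}$. **Proposition.** Let $B$ be a unital C*-algebra and let $\mathcal A$ be a Colombeau C*-subalgebra of $\mathcal G_B$. Then there is a complex Hilbert space $H$ such that $\mathcal A$ is isomorphic, as a Colombeau C*-algebra, to a Colombeau C*-subalgebra of $\mathcal G_{L(H)}$ and also to a Colombeau C*-subalgebra of $\mathcal B(\mathcal G_H)$. -/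

import Mathlib

open Filter Topology

universe u

noncomputable section

namespace Colombeau

/-! ### Nets indexed by `(0,1)` -/

/-- The index interval `(0,1)`. -/
abbrev Index : Type := Set.Ioo (0 : ℝ) 1

/-- "For small `ε`": the filter on `(0,1)` of the sets that contain `(0,η)` for some `η > 0`. -/
def small : Filter Index := comap (Subtype.val : Index → ℝ) (𝓝[>] (0 : ℝ))

/-- `‖u_ε‖ ≤ ε ^ b` for small `ε`. -/
def OrderGE {E : Type*} [NormedAddCommGroup E] (u : Index → E) (b : ℝ) : Prop :=
  ∀ᶠ ε in small, ‖u ε‖ ≤ (ε : ℝ) ^ b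

section Nets

variable {E F G : Type*} [NormedAddCommGroup E] [NormedAddCommGroup F] [NormedAddCommGroup G]

theorem small_lt {η : ℝ} (hη : 0 < η) : ∀ᶠ ε : Index in small, (ε : ℝ) < η :=
  (eventually_nhdsWithin_of_eventually_nhds (eventually_lt_nhds hη)).comap _

theorem OrderGE.of_norm_le {u : Index → E} {v : Index → F} {b : ℝ} (hv : OrderGE v b)
    (h : ∀ ε, ‖u ε‖ ≤ ‖v ε‖) : OrderGE u b :=
  hv.mono fun ε hε => (h ε).trans hε

theorem OrderGE.anti {u : Index → E} {b c : ℝ} (hu : OrderGE u b) (h : c ≤ b) : OrderGE u c :=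
  hu.mono fun ε hε => hε.trans (Real.rpow_le_rpow_of_exponent_ge ε.2.1 ε.2.2.le h)

theorem orderGE_zero (b : ℝ) : OrderGE (0 : Index → E) b :=
  Eventually.of_forall fun ε => by simpa using Real.rpow_nonneg ε.2.1.le b

theorem small_const_mul (C : ℝ) {b c : ℝ} (h : c < b) :
    ∀ᶠ ε : Index in small, C * (ε : ℝ) ^ b ≤ (ε : ℝ) ^ c := by
  have hbc : 0 < b - c := by linarith
  have hη : (0 : ℝ) < (1 / (|C| + 1)) ^ (1 / (b - c)) := by positivity
  filter_upwards [small_lt hη] with ε hε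
  have h0 : (0 : ℝ) < ε := ε.2.1
  have h1 : (ε : ℝ) ^ (b - c) ≤ 1 / (|C| + 1) := by
    have := Real.rpow_le_rpow h0.le hε.le hbc.le
    rwa [← Real.rpow_mul (by positivity), one_div_mul_cancel hbc.ne', Real.rpow_one] at this
  have h2 : (ε : ℝ) ^ b = (ε : ℝ) ^ (b - c) * (ε : ℝ) ^ c := by
    rw [← Real.rpow_add h0]; ring_nf
  have h3 : (0 : ℝ) < (ε : ℝ) ^ c := Real.rpow_pos_of_pos h0 c
  have h4 : C * (ε : ℝ) ^ (b - c) ≤ 1 := by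
    calc C * (ε : ℝ) ^ (b - c) ≤ (|C| + 1) * (1 / (|C| + 1)) := by
          apply mul_le_mul _ h1 (Real.rpow_nonneg h0.le _) (by positivity)
          linarith [le_abs_self C]
      _ = 1 := by field_simp
  rw [h2, ← mul_assoc]
  nlinarith

theorem OrderGE.add {u v : Index → E} {b c : ℝ} (hu : OrderGE u b) (hv : OrderGE v b)
    (h : c < b) : OrderGE (u + v) c := by
  filter_upwards [hu, hv, small_const_mul 2 h] with ε h1 h2 h3
  have := norm_add_le (u ε) (v ε)
  simp only [Pi.add_apply]
  linarith

theorem OrderGE.mul {u : Index → E} {v : Index → F} {w : Index → G} {b c : ℝ}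
    (hu : OrderGE u b) (hv : OrderGE v c) (h : ∀ ε, ‖w ε‖ ≤ ‖u ε‖ * ‖v ε‖) :
    OrderGE w (b + c) := by
  filter_upwards [hu, hv] with ε h1 h2
  refine (h ε).trans ?_
  rw [Real.rpow_add ε.2.1]
  exact mul_le_mul h1 h2 (norm_nonneg _) (Real.rpow_nonneg ε.2.1.le _)

end Nets

/-! ### The Colombeau space of a normed space -/

/-- Moderate nets: `‖u_ε‖ ≤ ε ^ (-N)` for small `ε`, for some `N ∈ ℕ`. -/
def moderateNets (E : Type*) [NormedAddCommGroup E] : AddSubgroup (Index → E) where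
  carrier := {u | ∃ N : ℕ, OrderGE u (-(N : ℝ))}
  zero_mem' := ⟨0, orderGE_zero _⟩
  add_mem' := by
    rintro u v ⟨N, hN⟩ ⟨M, hM⟩
    refine ⟨N + M + 1, OrderGE.add (b := -((N : ℝ) + M)) (hN.anti ?_) (hM.anti ?_) ?_⟩
    · have : (0 : ℝ) ≤ M := M.cast_nonneg
      linarith
    · have : (0 : ℝ) ≤ N := N.cast_nonneg
      linarith
    · push_cast; linarith
  neg_mem' := by
    rintro u ⟨N, hN⟩
    exact ⟨N, hN.of_norm_le fun ε => by simp⟩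

/-- Negligible nets: `‖u_ε‖ ≤ ε ^ m` for small `ε`, for all `m ∈ ℕ`. -/
def negligibleNets (E : Type*) [NormedAddCommGroup E] : AddSubgroup (Index → E) where
  carrier := {u | ∀ m : ℕ, OrderGE u (m : ℝ)}
  zero_mem' := fun _ => orderGE_zero _
  add_mem' := by
    intro u v hu hv m
    exact OrderGE.add (hu (m + 1)) (hv (m + 1)) (by push_cast; linarith)
  neg_mem' := by
    intro u hu m
    exact (hu m).of_norm_le fun ε => by simp

/-- The Colombeau space `𝒢_E`: moderate nets modulo negligible nets. -/
def Space (E : Type*) [NormedAddCommGroup E] : Type _ :=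
  moderateNets E ⧸ (negligibleNets E).addSubgroupOf (moderateNets E)

/-- The ring of Colombeau generalized complex numbers. -/
abbrev GenComplex : Type := Space ℂ

section Space

variable {E F G : Type*} [NormedAddCommGroup E] [NormedAddCommGroup F] [NormedAddCommGroup G]

instance : AddCommGroup (Space E) :=
  inferInstanceAs (AddCommGroup (moderateNets E ⧸ (negligibleNets E).addSubgroupOf _))

/-- The class `[(u_ε)_ε]` of a moderate net. -/
def mk (u : moderateNets E) : Space E := QuotientAddGroup.mk u

theorem mem_moderateNets {u : Index → E} : u ∈ moderateNets E ↔ ∃ b : ℝ, OrderGE u b := by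
  constructor
  · rintro ⟨N, hN⟩
    exact ⟨_, hN⟩
  · rintro ⟨b, hb⟩
    obtain ⟨N, hN⟩ := exists_nat_ge (-b)
    exact ⟨N, hb.anti (by linarith)⟩

theorem mem_negligibleNets {u : Index → E} : u ∈ negligibleNets E ↔ ∀ b : ℝ, OrderGE u b := by
  constructor
  · intro hu b
    obtain ⟨N, hN⟩ := exists_nat_ge b
    exact (hu N).anti hN
  · exact fun hu m => hu m

theorem mk_surj (x : Space E) : ∃ u, mk u = x := Quotient.exists_rep x

theorem mk_eq_mk {u v : moderateNets E} : mk u = mk v ↔ (-u.1 + v.1) ∈ negligibleNets E := by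
  exact QuotientAddGroup.eq

theorem mk_eq_zero {u : moderateNets E} : mk u = 0 ↔ u.1 ∈ negligibleNets E := by
  have h : (0 : Space E) = mk 0 := rfl
  rw [h, mk_eq_mk, ← neg_mem_iff]
  simp

theorem mk_add (u v : moderateNets E) : mk (u + v) = mk u + mk v := rfl

theorem mk_neg (u : moderateNets E) : mk (-u) = -mk u := rfl

/-- A biadditive map `f` with `‖f x y‖ ≤ ‖x‖ * ‖y‖` acts on Colombeau spaces componentwise:
`([(u_ε)_ε], [(v_ε)_ε]) ↦ [(f u_ε v_ε)_ε]`. -/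
def map₂ (f : E → F → G) (hl : ∀ x x' y, f (x + x') y = f x y + f x' y)
    (hr : ∀ x y y', f x (y + y') = f x y + f x y') (hf : ∀ x y, ‖f x y‖ ≤ ‖x‖ * ‖y‖) :
    Space E → Space F → Space G :=
  Quotient.map₂ (fun u v => ⟨fun ε => f (u.1 ε) (v.1 ε), by
      obtain ⟨b, hb⟩ := mem_moderateNets.1 u.2
      obtain ⟨c, hc⟩ := mem_moderateNets.1 v.2
      exact mem_moderateNets.2 ⟨b + c, hb.mul hc fun ε => hf _ _⟩⟩) (by
    intro u u' hu v v' hv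
    have hu' := mk_eq_mk.1 (Quotient.sound hu : mk u = mk u')
    have hv' := mk_eq_mk.1 (Quotient.sound hv : mk v = mk v')
    apply Quotient.exact
    change mk _ = mk _
    rw [mk_eq_mk]
    have key : (-(fun ε => f (u.1 ε) (v.1 ε)) + fun ε => f (u'.1 ε) (v'.1 ε) : Index → G)
        = (fun ε => f ((-u.1 + u'.1) ε) (v.1 ε)) + fun ε => f (u'.1 ε) ((-v.1 + v'.1) ε) := by
      funext ε
      have h1 := hl (u.1 ε) ((-u.1 + u'.1) ε) (v.1 ε)
      have h2 := hr (u'.1 ε) (v.1 ε) ((-v.1 + v'.1) ε)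
      simp only [Pi.add_apply, Pi.neg_apply, add_neg_cancel_left] at h1 h2 ⊢
      rw [h2, h1]
      abel
    change (-(fun ε => f (u.1 ε) (v.1 ε)) + fun ε => f (u'.1 ε) (v'.1 ε) : Index → G) ∈ _
    rw [key]
    refine add_mem ?_ ?_
    · rw [mem_negligibleNets] at hu' ⊢
      intro b
      obtain ⟨c, hc⟩ := mem_moderateNets.1 v.2
      have := (hu' (b - c)).mul hc (fun ε => hf ((-u.1 + u'.1) ε) (v.1 ε))
      rwa [sub_add_cancel] at this
    · rw [mem_negligibleNets] at hv' ⊢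
      intro b
      obtain ⟨c, hc⟩ := mem_moderateNets.1 u'.2
      have := hc.mul (hv' (b - c)) (fun ε => hf (u'.1 ε) ((-v.1 + v'.1) ε))
      rwa [add_sub_cancel] at this)

/-! ### Algebraic structure -/

instance {B : Type*} [NormedRing B] : Mul (Space B) :=
  ⟨map₂ (fun x y => x * y) (fun _ _ _ => add_mul _ _ _) (fun _ _ _ => mul_add _ _ _) norm_mul_le⟩

/-- The constant net. -/
def const (x : E) : moderateNets E :=
  ⟨fun _ => x, mem_moderateNets.2 ⟨-1, by
    filter_upwards [small_const_mul ‖x‖ (show (-1 : ℝ) < 0 by norm_num)] with ε hε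
    simpa using hε⟩⟩

instance {B : Type*} [NormedRing B] : One (Space B) := ⟨mk (const 1)⟩

theorem mk_congr {u v : moderateNets E} (h : ∀ ε, u.1 ε = v.1 ε) : mk u = mk v :=
  congrArg mk (Subtype.ext (funext h))

instance {B : Type*} [NormedRing B] : Ring (Space B) where
  __ := (inferInstance : AddCommGroup (Space B))
  left_distrib := by
    rintro ⟨u⟩ ⟨v⟩ ⟨w⟩
    exact mk_congr fun ε => mul_add _ _ _
  right_distrib := by
    rintro ⟨u⟩ ⟨v⟩ ⟨w⟩
    exact mk_congr fun ε => add_mul _ _ _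
  zero_mul := by
    rintro ⟨u⟩
    exact mk_congr fun ε => zero_mul _
  mul_zero := by
    rintro ⟨u⟩
    exact mk_congr fun ε => mul_zero _
  mul_assoc := by
    rintro ⟨u⟩ ⟨v⟩ ⟨w⟩
    exact mk_congr fun ε => mul_assoc _ _ _
  one_mul := by
    rintro ⟨u⟩
    exact mk_congr fun ε => one_mul _
  mul_one := by
    rintro ⟨u⟩
    exact mk_congr fun ε => mul_one _

instance : CommRing GenComplex where
  __ := (inferInstance : Ring GenComplex)
  mul_comm := by
    rintro ⟨u⟩ ⟨v⟩
    exact mk_congr fun ε => mul_comm _ _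

instance [NormedSpace ℂ E] : SMul GenComplex (Space E) :=
  ⟨map₂ (fun z x => z • x) (fun _ _ _ => add_smul _ _ _) (fun _ _ _ => smul_add _ _ _)
    norm_smul_le⟩

instance [NormedSpace ℂ E] : Module GenComplex (Space E) where
  one_smul := by
    rintro ⟨u⟩
    exact mk_congr fun ε => one_smul _ _
  mul_smul := by
    rintro ⟨a⟩ ⟨b⟩ ⟨u⟩
    exact mk_congr fun ε => mul_smul _ _ _
  smul_zero := by
    rintro ⟨a⟩
    exact mk_congr fun ε => smul_zero _
  smul_add := by
    rintro ⟨a⟩ ⟨u⟩ ⟨v⟩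
    exact mk_congr fun ε => smul_add _ _ _
  add_smul := by
    rintro ⟨a⟩ ⟨b⟩ ⟨u⟩
    exact mk_congr fun ε => add_smul _ _ _
  zero_smul := by
    rintro ⟨u⟩
    exact mk_congr fun ε => zero_smul _ _

instance {B : Type*} [NormedRing B] [NormedAlgebra ℂ B] : Algebra GenComplex (Space B) :=
  Algebra.ofModule
    (by
      rintro ⟨a⟩ ⟨u⟩ ⟨v⟩
      exact mk_congr fun ε => smul_mul_assoc _ _ _)
    (by
      rintro ⟨a⟩ ⟨u⟩ ⟨v⟩
      exact mk_congr fun ε => mul_smul_comm _ _ _)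

/-- The componentwise involution `[(u_ε)_ε]^* = [(u_ε^*)_ε]`. -/
instance {B : Type*} [NormedRing B] [StarRing B] [NormedStarGroup B] : Star (Space B) :=
  ⟨Quotient.map (fun u => ⟨fun ε => star (u.1 ε), by
      obtain ⟨b, hb⟩ := mem_moderateNets.1 u.2
      exact mem_moderateNets.2 ⟨b, hb.of_norm_le fun ε => by simp⟩⟩) (by
    intro u v h
    have h' := mk_eq_mk.1 (Quotient.sound h : mk u = mk v)
    apply Quotient.exact
    change mk _ = mk _
    rw [mk_eq_mk]
    intro m
    refine (h' m).of_norm_le fun ε => ?_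
    change ‖-star (u.1 ε) + star (v.1 ε)‖ ≤ ‖-u.1 ε + v.1 ε‖
    rw [← star_neg, ← star_add, norm_star])⟩

instance {B : Type*} [NormedRing B] [StarRing B] [NormedStarGroup B] : StarRing (Space B) where
  star_involutive := by
    rintro ⟨u⟩
    exact mk_congr fun ε => star_star _
  star_mul := by
    rintro ⟨u⟩ ⟨v⟩
    exact mk_congr fun ε => star_mul _ _
  star_add := by
    rintro ⟨u⟩ ⟨v⟩
    exact mk_congr fun ε => star_add _ _

instance {B : Type*} [NormedRing B] [StarRing B] [NormedStarGroup B] [NormedAlgebra ℂ B]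
    [StarModule ℂ B] : StarModule GenComplex (Space B) where
  star_smul := by
    rintro ⟨a⟩ ⟨u⟩
    exact mk_congr fun ε => star_smul _ _

/-! ### The ultra-pseudo-norm -/

/-- The valuation `sup {b ∈ ℝ : ‖u_ε‖ ≤ ε ^ b for small ε}` of a net. -/
def valuation (u : Index → E) : EReal := ⨆ b ∈ {b : ℝ | OrderGE u b}, (b : EReal)

/-- The sharp norm `e ^ (-v(u))` of a net (with `e ^ (-∞) = 0`). -/
def sharpNorm (u : Index → E) : ℝ := (EReal.exp (-valuation u)).toReal

theorem le_valuation_iff {u : Index → E} {r : ℝ} :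
    (r : EReal) ≤ valuation u ↔ ∀ b < r, OrderGE u b := by
  constructor
  · intro h b hb
    have h1 : (b : EReal) < valuation u := lt_of_lt_of_le (EReal.coe_lt_coe_iff.2 hb) h
    obtain ⟨c, hc⟩ := lt_iSup_iff.1 h1
    obtain ⟨hc1, hc2⟩ := lt_iSup_iff.1 hc
    exact OrderGE.anti hc1 (EReal.coe_lt_coe_iff.1 hc2).le
  · intro h
    refine le_of_forall_lt fun x hx => ?_
    obtain ⟨q, hq1, hq2⟩ := EReal.lt_iff_exists_real_btwn.1 hx
    exact hq1.trans_le (le_iSup₂_of_le q (h q (EReal.coe_lt_coe_iff.1 hq2)) le_rfl)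

theorem valuation_ne_bot {u : Index → E} (hu : u ∈ moderateNets E) : valuation u ≠ ⊥ := by
  obtain ⟨b, hb⟩ := mem_moderateNets.1 hu
  have : (b : EReal) ≤ valuation u := le_iSup₂_of_le b hb le_rfl
  intro h
  rw [h, le_bot_iff] at this
  exact EReal.coe_ne_bot b this

theorem sharpNorm_nonneg (u : Index → E) : 0 ≤ sharpNorm u := ENNReal.toReal_nonneg

theorem exp_neg_valuation_ne_top {u : Index → E} (hu : u ∈ moderateNets E) :
    EReal.exp (-valuation u) ≠ ⊤ := by
  rw [Ne, EReal.exp_eq_top_iff, EReal.neg_eq_top_iff]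
  exact valuation_ne_bot hu

theorem sharpNorm_le_exp_iff {u : Index → E} (hu : u ∈ moderateNets E) {r : ℝ} :
    sharpNorm u ≤ Real.exp (-r) ↔ ∀ b < r, OrderGE u b := by
  rw [← le_valuation_iff, sharpNorm,
    ← ENNReal.le_ofReal_iff_toReal_le (exp_neg_valuation_ne_top hu) (Real.exp_pos _).le,
    ← EReal.exp_coe, EReal.exp_le_exp_iff, EReal.coe_neg, EReal.neg_le_neg_iff]

theorem sharpNorm_eq_zero_iff {u : Index → E} (hu : u ∈ moderateNets E) :
    sharpNorm u = 0 ↔ u ∈ negligibleNets E := by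
  rw [mem_negligibleNets]
  constructor
  · intro h b
    refine (sharpNorm_le_exp_iff hu (r := b + 1)).1 ?_ b (by linarith)
    rw [h]
    exact (Real.exp_pos _).le
  · intro h
    refine le_antisymm (le_of_forall_pos_le_add fun δ hδ => ?_) (sharpNorm_nonneg u)
    have := (sharpNorm_le_exp_iff hu (r := -Real.log δ)).2 fun b _ => h b
    rwa [neg_neg, Real.exp_log hδ, ← zero_add δ] at this

theorem valuation_le_of_neg_add {u v : Index → E} (h : -u + v ∈ negligibleNets E) :
    valuation u ≤ valuation v := by
  refine iSup₂_le fun b hb => le_valuation_iff.2 fun c hc => ?_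
  have := OrderGE.add hb (mem_negligibleNets.1 h b) hc
  rwa [add_neg_cancel_left] at this

/-- The ultra-pseudo-norm `[(u_ε)_ε] ↦ e ^ (-v(‖u_ε‖))` on `𝒢_E`. -/
def pseudoNorm : Space E → ℝ :=
  Quotient.lift (fun u => sharpNorm u.1) (by
    intro u v h
    have h1 := mk_eq_mk.1 (Quotient.sound h : mk u = mk v)
    have h2 := mk_eq_mk.1 (Quotient.sound h : mk u = mk v).symm
    have : valuation u.1 = valuation v.1 :=
      le_antisymm (valuation_le_of_neg_add h1) (valuation_le_of_neg_add h2)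
    simp only [sharpNorm, this])

theorem pseudoNorm_mk (u : moderateNets E) : pseudoNorm (mk u) = sharpNorm u.1 := rfl

theorem pseudoNorm_mk_le_exp_iff {u : moderateNets E} {r : ℝ} :
    pseudoNorm (mk u) ≤ Real.exp (-r) ↔ ∀ b < r, OrderGE u.1 b :=
  sharpNorm_le_exp_iff u.2

theorem pseudoNorm_nonneg (x : Space E) : 0 ≤ pseudoNorm x := by
  obtain ⟨u, rfl⟩ := mk_surj x
  exact sharpNorm_nonneg _

theorem pseudoNorm_eq_zero {x : Space E} : pseudoNorm x = 0 ↔ x = 0 := by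
  obtain ⟨u, rfl⟩ := mk_surj x
  rw [pseudoNorm_mk, sharpNorm_eq_zero_iff u.2, mk_eq_zero]

theorem pseudoNorm_neg (x : Space E) : pseudoNorm (-x) = pseudoNorm x := by
  obtain ⟨u, rfl⟩ := mk_surj x
  rw [← mk_neg, pseudoNorm_mk, pseudoNorm_mk]
  simp [sharpNorm, valuation, OrderGE]

theorem pseudoNorm_add_le_max (x y : Space E) : pseudoNorm (x + y) ≤ max (pseudoNorm x) (pseudoNorm y) := by
  rcases (le_max_of_le_left (pseudoNorm_nonneg x) : 0 ≤ max (pseudoNorm x) (pseudoNorm y)).eq_or_lt with h | h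
  · have hx : x = 0 := pseudoNorm_eq_zero.1
      (le_antisymm ((le_max_left _ _).trans h.ge) (pseudoNorm_nonneg x))
    rw [hx, zero_add]
    exact le_max_right _ _
  · obtain ⟨u, rfl⟩ := mk_surj x
    obtain ⟨v, rfl⟩ := mk_surj y
    obtain ⟨r, hr⟩ : ∃ r, max (pseudoNorm (mk u)) (pseudoNorm (mk v)) = Real.exp (-r) :=
      ⟨-Real.log (max (pseudoNorm (mk u)) (pseudoNorm (mk v))), by rw [neg_neg, Real.exp_log h]⟩
    have hu : pseudoNorm (mk u) ≤ Real.exp (-r) := (le_max_left _ _).trans hr.le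
    have hv : pseudoNorm (mk v) ≤ Real.exp (-r) := (le_max_right _ _).trans hr.le
    rw [hr, ← mk_add, pseudoNorm_mk_le_exp_iff]
    intro b hb
    obtain ⟨c, hbc, hcr⟩ := exists_between hb
    exact OrderGE.add (pseudoNorm_mk_le_exp_iff.1 hu c hcr) (pseudoNorm_mk_le_exp_iff.1 hv c hcr) hbc

theorem pseudoNorm_map₂_le (f : E → F → G) (hl : ∀ x x' y, f (x + x') y = f x y + f x' y)
    (hr : ∀ x y y', f x (y + y') = f x y + f x y') (hf : ∀ x y, ‖f x y‖ ≤ ‖x‖ * ‖y‖)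
    (x : Space E) (y : Space F) : pseudoNorm (map₂ f hl hr hf x y) ≤ pseudoNorm x * pseudoNorm y := by
  rcases (pseudoNorm_nonneg x).eq_or_lt with h | h
  · have h0 : map₂ f hl hr hf 0 y = 0 := by
      obtain ⟨v, rfl⟩ := mk_surj y
      exact mk_congr fun ε => norm_le_zero_iff.1 ((hf _ _).trans (by simp))
    rw [pseudoNorm_eq_zero.1 h.symm, h0, pseudoNorm_eq_zero.2 rfl]
    exact mul_nonneg (pseudoNorm_nonneg _) (pseudoNorm_nonneg _)
  rcases (pseudoNorm_nonneg y).eq_or_lt with h' | h'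
  · have h0 : map₂ f hl hr hf x 0 = 0 := by
      obtain ⟨v, rfl⟩ := mk_surj x
      exact mk_congr fun ε => norm_le_zero_iff.1 ((hf _ _).trans (by simp))
    rw [pseudoNorm_eq_zero.1 h'.symm, h0, pseudoNorm_eq_zero.2 rfl]
    exact mul_nonneg (pseudoNorm_nonneg _) (pseudoNorm_nonneg _)
  obtain ⟨u, rfl⟩ := mk_surj x
  obtain ⟨v, rfl⟩ := mk_surj y
  obtain ⟨r, hr1⟩ : ∃ r, pseudoNorm (mk u) = Real.exp (-r) :=
    ⟨-Real.log (pseudoNorm (mk u)), by rw [neg_neg, Real.exp_log h]⟩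
  obtain ⟨s, hs1⟩ : ∃ s, pseudoNorm (mk v) = Real.exp (-s) :=
    ⟨-Real.log (pseudoNorm (mk v)), by rw [neg_neg, Real.exp_log h']⟩
  rw [hr1, hs1, ← Real.exp_add, ← neg_add]
  refine pseudoNorm_mk_le_exp_iff.2 fun b hb => ?_
  have h1 := pseudoNorm_mk_le_exp_iff.1 hr1.le (r - (r + s - b) / 2) (by linarith)
  have h2 := pseudoNorm_mk_le_exp_iff.1 hs1.le (s - (r + s - b) / 2) (by linarith)
  have h3 := h1.mul h2 (fun ε => hf (u.1 ε) (v.1 ε))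
  exact h3.anti (by linarith)

/-- The distance of `u` and `v` in `𝒢_E` is the ultra-pseudo-norm of `u - v`. -/
instance : NormedAddCommGroup (Space E) :=
  AddGroupNorm.toNormedAddCommGroup
    { toFun := pseudoNorm
      map_zero' := pseudoNorm_eq_zero.2 rfl
      add_le' := fun x y => (pseudoNorm_add_le_max x y).trans
        (max_le_add_of_nonneg (pseudoNorm_nonneg x) (pseudoNorm_nonneg y))
      neg' := pseudoNorm_neg
      eq_zero_of_map_eq_zero' := fun _ => pseudoNorm_eq_zero.1 }

instance {B : Type*} [NormedRing B] : NormedRing (Space B) where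
  __ := (inferInstance : Ring (Space B))
  __ := (inferInstance : NormedAddCommGroup (Space B))
  norm_mul_le := pseudoNorm_map₂_le _ _ _ _

instance [NormedSpace ℂ E] : IsBoundedSMul GenComplex (Space E) :=
  IsBoundedSMul.of_norm_smul_le (pseudoNorm_map₂_le _ _ _ _)

end Space

/-! ### Colombeau C⋆-algebras -/

/-- A `GenComplex`-algebra with involution and a complete submultiplicative ultra-pseudo-norm
satisfying `‖1‖ = 1` and `‖u^* u‖ = ‖u‖ ^ 2`. That the norm is definite and submultiplicative,
induces the distance, and that the involution is additive, involutive and reverses products, is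
part of `NormedRing` and `StarRing`. -/
structure IsColombeauCStarAlgebra (A : Type*) [NormedRing A] [StarRing A]
    [Algebra GenComplex A] : Prop where
  norm_add_le_max : ∀ u v : A, ‖u + v‖ ≤ max ‖u‖ ‖v‖
  norm_smul_le : ∀ (z : GenComplex) (u : A), ‖z • u‖ ≤ ‖z‖ * ‖u‖
  norm_one : ‖(1 : A)‖ = 1
  star_smul : ∀ (z : GenComplex) (u : A), star (z • u) = star z • star u
  norm_star_mul_self : ∀ u : A, ‖star u * u‖ = ‖u‖ ^ 2
  complete : CompleteSpace A

/-- A Colombeau C⋆-subalgebra: a unital `⋆`-subalgebra over `GenComplex` that is a Colombeau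
C⋆-algebra for the inherited operations and norm. -/
def IsColombeauCStarSubalgebra {A : Type*} [NormedRing A] [StarRing A] [Algebra GenComplex A]
    [StarModule GenComplex A] (S : StarSubalgebra GenComplex A) : Prop :=
  IsColombeauCStarAlgebra S

/-- Isomorphism of Colombeau C⋆-algebras: a bijective `GenComplex`-linear multiplicative map that
preserves the involution and the ultra-pseudo-norm. -/
def Isomorphic (A A' : Type*) [NormedRing A] [StarRing A] [Algebra GenComplex A]
    [NormedRing A'] [StarRing A'] [Algebra GenComplex A'] : Prop :=
  ∃ φ : A ≃⋆ₐ[GenComplex] A', ∀ u, ‖φ u‖ = ‖u‖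

/-! ### The operators with adjoint on `𝒢_H` -/

section Operators

variable {H : Type*} [NormedAddCommGroup H] [InnerProductSpace ℂ H]

/-- The `GenComplex`-valued inner product `[(⟪u_ε, v_ε⟫)_ε]` on `𝒢_H`, linear in the second
variable. -/
def genInner : Space H → Space H → GenComplex :=
  map₂ (fun x y => inner ℂ x y) (fun _ _ _ => inner_add_left _ _ _)
    (fun _ _ _ => inner_add_right _ _ _) norm_inner_le_norm

theorem genInner_add_left (x y z : Space H) :
    genInner (x + y) z = genInner x z + genInner y z := by
  obtain ⟨u, rfl⟩ := mk_surj x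
  obtain ⟨v, rfl⟩ := mk_surj y
  obtain ⟨w, rfl⟩ := mk_surj z
  exact mk_congr fun ε => inner_add_left _ _ _

theorem genInner_add_right (x y z : Space H) :
    genInner x (y + z) = genInner x y + genInner x z := by
  obtain ⟨u, rfl⟩ := mk_surj x
  obtain ⟨v, rfl⟩ := mk_surj y
  obtain ⟨w, rfl⟩ := mk_surj z
  exact mk_congr fun ε => inner_add_right _ _ _

theorem genInner_smul_left (a : GenComplex) (x y : Space H) :
    genInner (a • x) y = star a * genInner x y := by
  obtain ⟨c, rfl⟩ := mk_surj a
  obtain ⟨u, rfl⟩ := mk_surj x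
  obtain ⟨v, rfl⟩ := mk_surj y
  exact mk_congr fun ε => inner_smul_left _ _ _

theorem genInner_smul_right (a : GenComplex) (x y : Space H) :
    genInner x (a • y) = a * genInner x y := by
  obtain ⟨c, rfl⟩ := mk_surj a
  obtain ⟨u, rfl⟩ := mk_surj x
  obtain ⟨v, rfl⟩ := mk_surj y
  exact mk_congr fun ε => inner_smul_right _ _ _

theorem genInner_star (x y : Space H) : star (genInner x y) = genInner y x := by
  obtain ⟨u, rfl⟩ := mk_surj x
  obtain ⟨v, rfl⟩ := mk_surj y
  exact mk_congr fun ε => inner_conj_symm _ _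

theorem genInner_self_eq_zero {x : Space H} (h : genInner x x = 0) : x = 0 := by
  obtain ⟨u, rfl⟩ := mk_surj x
  have h' : (fun ε => inner ℂ (u.1 ε) (u.1 ε)) ∈ negligibleNets ℂ := mk_eq_zero.1 h
  rw [mk_eq_zero, mem_negligibleNets]
  intro b
  filter_upwards [mem_negligibleNets.1 h' (b + b)] with ε hε
  rw [inner_self_eq_norm_sq_to_K, Real.rpow_add ε.2.1] at hε
  simp only [norm_pow, RCLike.norm_ofReal, abs_norm] at hε
  exact abs_le_of_sq_le_sq' (by nlinarith) (Real.rpow_nonneg ε.2.1.le _) |>.2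

theorem genInner_ext_right {x y : Space H} (h : ∀ z, genInner z x = genInner z y) : x = y := by
  have h0 : ∀ z, genInner z (x - y) = 0 := fun z => by
    have := genInner_add_right z (x - y) y
    rw [sub_add_cancel, h z] at this
    exact right_eq_add.1 this
  exact sub_eq_zero.1 (genInner_self_eq_zero (h0 _))

/-- `S` is an adjoint of `T`. -/
def IsAdjoint (T S : Space H →L[GenComplex] Space H) : Prop :=
  ∀ x y, genInner (T x) y = genInner x (S y)

theorem IsAdjoint.symm {T S : Space H →L[GenComplex] Space H} (h : IsAdjoint T S) :
    IsAdjoint S T := fun x y => by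
  rw [← genInner_star, ← h, genInner_star]

theorem IsAdjoint.unique {T S S' : Space H →L[GenComplex] Space H} (h : IsAdjoint T S)
    (h' : IsAdjoint T S') : S = S' :=
  ContinuousLinearMap.ext fun y => genInner_ext_right fun z => by rw [← h, ← h']

theorem IsAdjoint.add {T S T' S' : Space H →L[GenComplex] Space H} (h : IsAdjoint T S)
    (h' : IsAdjoint T' S') : IsAdjoint (T + T') (S + S') := fun x y => by
  simp only [add_apply, genInner_add_left, genInner_add_right, h x y, h' x y]

theorem IsAdjoint.mul {T S T' S' : Space H →L[GenComplex] Space H} (h : IsAdjoint T S)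
    (h' : IsAdjoint T' S') : IsAdjoint (T * T') (S' * S) := fun _ _ =>
  (h _ _).trans (h' _ _)

theorem IsAdjoint.smul {T S : Space H →L[GenComplex] Space H} (h : IsAdjoint T S)
    (a : GenComplex) : IsAdjoint (a • T) (star a • S) := fun x y => by
  simp only [smul_apply, genInner_smul_left, genInner_smul_right, h x y]

theorem isAdjoint_one : IsAdjoint (1 : Space H →L[GenComplex] Space H) 1 := fun _ _ => rfl

variable (H) in
/-- The continuous `GenComplex`-linear operators on `𝒢_H` that have an adjoint, as a subalgebra. -/
def adjointable : Subalgebra GenComplex (Space H →L[GenComplex] Space H) where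
  carrier := {T | ∃ S, IsAdjoint T S}
  mul_mem' := by
    rintro T T' ⟨S, h⟩ ⟨S', h'⟩
    exact ⟨_, h.mul h'⟩
  add_mem' := by
    rintro T T' ⟨S, h⟩ ⟨S', h'⟩
    exact ⟨_, h.add h'⟩
  algebraMap_mem' a := ⟨_, by
    rw [Algebra.algebraMap_eq_smul_one]
    exact isAdjoint_one.smul a⟩

variable (H) in
/-- The algebra `ℬ(𝒢_H)`. -/
def BoundedOp : Type _ := adjointable H

instance : Ring (BoundedOp H) := inferInstanceAs (Ring (adjointable H))

instance : Algebra GenComplex (BoundedOp H) :=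
  inferInstanceAs (Algebra GenComplex (adjointable H))

/-- The underlying operator on `𝒢_H`. -/
def BoundedOp.toCLM (T : BoundedOp H) : Space H →L[GenComplex] Space H := Subtype.val T

theorem BoundedOp.ext {T T' : BoundedOp H} (h : T.toCLM = T'.toCLM) : T = T' := Subtype.ext h

/-- The adjoint as involution. -/
instance : Star (BoundedOp H) :=
  ⟨fun T => ⟨Classical.choose (Subtype.prop T),
    ⟨_, (Classical.choose_spec (Subtype.prop T)).symm⟩⟩⟩

theorem BoundedOp.isAdjoint_star (T : BoundedOp H) : IsAdjoint T.toCLM (star T).toCLM :=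
  Classical.choose_spec (Subtype.prop T)

theorem BoundedOp.star_eq {T S : BoundedOp H} (h : IsAdjoint T.toCLM S.toCLM) : star T = S :=
  BoundedOp.ext (T.isAdjoint_star.unique h)

instance : StarRing (BoundedOp H) where
  star_involutive T := BoundedOp.star_eq T.isAdjoint_star.symm
  star_mul T S := BoundedOp.star_eq (T.isAdjoint_star.mul S.isAdjoint_star)
  star_add T S := BoundedOp.star_eq (T.isAdjoint_star.add S.isAdjoint_star)

instance : StarModule GenComplex (BoundedOp H) where
  star_smul a T := BoundedOp.star_eq (T.isAdjoint_star.smul a)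

/-- The operator ultra-pseudo-norm `inf {C ≥ 0 : ‖T u‖ ≤ C * ‖u‖ for all u}`. -/
def opNorm (T : Space H →L[GenComplex] Space H) : ℝ :=
  sInf {C : ℝ | 0 ≤ C ∧ ∀ u, ‖T u‖ ≤ C * ‖u‖}

/-- The generalized number `[(ε ^ r)_ε]`. -/
def alphaPow (r : ℝ) : GenComplex :=
  mk ⟨fun ε => (((ε : ℝ) ^ r : ℝ) : ℂ), mem_moderateNets.2 ⟨r, Eventually.of_forall fun ε => by
    rw [Complex.norm_real, Real.norm_of_nonneg (Real.rpow_nonneg ε.2.1.le _)]⟩⟩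

theorem norm_alphaPow_le (r : ℝ) : ‖alphaPow r‖ ≤ Real.exp (-r) :=
  pseudoNorm_mk_le_exp_iff.2 fun b hb => OrderGE.anti (b := r) (Eventually.of_forall fun ε => by
    change ‖(((ε : ℝ) ^ r : ℝ) : ℂ)‖ ≤ _
    rw [Complex.norm_real, Real.norm_of_nonneg (Real.rpow_nonneg ε.2.1.le _)]) hb.le

theorem alphaPow_mul_neg (r : ℝ) : alphaPow (-r) * alphaPow r = 1 :=
  mk_congr fun ε => by
    change (((ε : ℝ) ^ (-r) : ℝ) : ℂ) * (((ε : ℝ) ^ r : ℝ) : ℂ) = 1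
    rw [← Complex.ofReal_mul, ← Real.rpow_add ε.2.1]
    simp

theorem exists_bound (T : Space H →L[GenComplex] Space H) :
    ∃ C : ℝ, 0 ≤ C ∧ ∀ u, ‖T u‖ ≤ C * ‖u‖ := by
  obtain ⟨δ, hδ, h⟩ := Metric.continuousAt_iff.1 (T.continuous.continuousAt (x := 0)) 1 one_pos
  refine ⟨2 / δ, by positivity, fun u => ?_⟩
  rcases eq_or_ne u 0 with rfl | hu
  · simp
  have hu' : 0 < ‖u‖ := norm_pos_iff.2 hu
  have hq : 0 < δ / (2 * ‖u‖) := by positivity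
  set r := -Real.log (δ / (2 * ‖u‖)) with hr
  have e1 : Real.exp (-r) = δ / (2 * ‖u‖) := by rw [hr, neg_neg, Real.exp_log hq]
  have h1 : ‖alphaPow r • u‖ < δ := by
    calc ‖alphaPow r • u‖ ≤ ‖alphaPow r‖ * ‖u‖ := norm_smul_le _ _
      _ ≤ δ / (2 * ‖u‖) * ‖u‖ := by
        rw [← e1]
        exact mul_le_mul_of_nonneg_right (norm_alphaPow_le r) hu'.le
      _ = δ / 2 := by field_simp
      _ < δ := by linarith
  have h2 : ‖T (alphaPow r • u)‖ ≤ 1 := by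
    have := h (x := alphaPow r • u) (by rwa [dist_zero_right])
    rw [map_zero, dist_zero_right] at this
    exact this.le
  have h3 : T u = alphaPow (-r) • T (alphaPow r • u) := by
    rw [map_smul, smul_smul, alphaPow_mul_neg, one_smul]
  have e2 : Real.exp (-(-r)) = 2 / δ * ‖u‖ := by
    rw [neg_neg, ← inv_inv (Real.exp r), ← Real.exp_neg, e1]
    field_simp
  calc ‖T u‖ ≤ ‖alphaPow (-r)‖ * ‖T (alphaPow r • u)‖ := by
        rw [h3]
        exact norm_smul_le _ _
    _ ≤ Real.exp (-(-r)) * 1 :=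
        mul_le_mul (norm_alphaPow_le _) h2 (norm_nonneg _) (Real.exp_pos _).le
    _ = 2 / δ * ‖u‖ := by rw [mul_one, e2]

theorem opNorm_nonneg (T : Space H →L[GenComplex] Space H) : 0 ≤ opNorm T :=
  Real.sInf_nonneg fun _ h => h.1

theorem le_opNorm (T : Space H →L[GenComplex] Space H) (u : Space H) :
    ‖T u‖ ≤ opNorm T * ‖u‖ := by
  rcases eq_or_ne u 0 with rfl | hu
  · simp
  rw [← div_le_iff₀ (norm_pos_iff.2 hu)]
  exact le_csInf (exists_bound T) fun C hC => (div_le_iff₀ (norm_pos_iff.2 hu)).2 (hC.2 u)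

theorem opNorm_le {T : Space H →L[GenComplex] Space H} {C : ℝ} (hC : 0 ≤ C)
    (h : ∀ u, ‖T u‖ ≤ C * ‖u‖) : opNorm T ≤ C :=
  csInf_le ⟨0, fun _ h => h.1⟩ ⟨hC, h⟩

instance : NormedAddCommGroup (BoundedOp H) :=
  AddGroupNorm.toNormedAddCommGroup
    { toFun := fun T => opNorm T.toCLM
      map_zero' := le_antisymm
        (opNorm_le le_rfl fun u => by
          change ‖(0 : Space H)‖ ≤ _
          simp)
        (opNorm_nonneg _)
      add_le' := fun T S => opNorm_le (add_nonneg (opNorm_nonneg _) (opNorm_nonneg _)) fun u => by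
        change ‖T.toCLM u + S.toCLM u‖ ≤ _
        rw [add_mul]
        exact (norm_add_le _ _).trans (add_le_add (le_opNorm _ u) (le_opNorm _ u))
      neg' := fun T => by
        have h : ∀ u, ‖(-T).toCLM u‖ = ‖T.toCLM u‖ := fun u => norm_neg (T.toCLM u)
        change opNorm _ = opNorm _
        simp only [opNorm, h]
      eq_zero_of_map_eq_zero' := fun T hT => BoundedOp.ext <| ContinuousLinearMap.ext fun u => by
        have h := le_opNorm T.toCLM u
        rw [show opNorm T.toCLM = 0 from hT, zero_mul] at h
        exact norm_le_zero_iff.1 h }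

instance : NormedRing (BoundedOp H) where
  __ := (inferInstance : Ring (BoundedOp H))
  __ := (inferInstance : NormedAddCommGroup (BoundedOp H))
  norm_mul_le T S := opNorm_le (mul_nonneg (opNorm_nonneg _) (opNorm_nonneg _)) fun u => by
    change ‖T.toCLM (S.toCLM u)‖ ≤ opNorm T.toCLM * opNorm S.toCLM * ‖u‖
    rw [mul_assoc]
    exact (le_opNorm _ _).trans (mul_le_mul_of_nonneg_left (le_opNorm _ _) (opNorm_nonneg _))

end Operators

end Colombeau

end

/-!
The result rests on the Gelfand–Naimark theorem: the unital C⋆-algebra `B` has an isometric unital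
representation `π : B → L(H)` on a Hilbert space. Applying `π` at each `ε` gives an isometric
`⋆`-homomorphism `𝒢_B → 𝒢_{L(H)}` (`Colombeau.Space.map`), and letting a net of operators act on a
net of vectors at each `ε` gives an isometric `⋆`-homomorphism `𝒢_{L(H)} → ℬ(𝒢_H)`
(`Colombeau.Space.toBoundedOp`). The image of a Colombeau C⋆-subalgebra under an isometric
`⋆`-homomorphism is again one, isomorphic to the first
(`Colombeau.exists_isomorphic_starSubalgebra`); so the images of `𝒜` under the first map and under
the composition of both are the two subalgebras sought.

That `𝒢_{L(H)} → ℬ(𝒢_H)` does not decrease norms is seen by choosing, for each `ε`, a vector `x_ε`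
in the unit ball with `‖T_ε‖ ≤ 2 ‖T_ε x_ε‖`: constant factors do not change the
ultra-pseudo-norm (`Colombeau.norm_mk_le_of_norm_le`), so no norm-attaining vectors are needed.

For Gelfand–Naimark, a functional of norm one that attains its norm at `1 + b^* b` takes the values
`1` at `1` and `‖b‖ ^ 2` at `b^* b`, and is then positive; its GNS representation does not decrease
the norm of `b`. The `ℓ²`-sum of these representations over all `b` is isometric.
-/

/-! ### States of a C⋆-algebra -/

section GelfandNaimark

open scoped ComplexOrder InnerProductSpace ENNReal

namespace CStarAlgebra

variable {B : Type*} [CStarAlgebra B]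

/-- The reality of `f` on selfadjoint elements follows from the bounds
`|Im (f b) + t| ≤ ‖b + i t‖ ≤ √(‖b‖ ^ 2 + t ^ 2)`, by letting the real number `t` vary. -/
theorem im_apply_eq_zero_of_norm_le_one {f : StrongDual ℂ B} (hf : ‖f‖ ≤ 1) (h1 : f 1 = 1)
    {b : B} (hb : IsSelfAdjoint b) : (f b).im = 0 := by
  have key : ∀ t : ℝ, ((f b).im + t) ^ 2 ≤ ‖b‖ ^ 2 + t ^ 2 := fun t => by
    have h2 : star (b + (t * Complex.I) • (1 : B)) * (b + (t * Complex.I) • (1 : B))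
        = b * b + ((t : ℂ) ^ 2) • (1 : B) := by
      simp only [star_add, star_smul, hb.star_eq, star_one, add_mul, mul_add, smul_mul_assoc,
        mul_smul_comm, one_mul, mul_one, Complex.star_def, map_mul, Complex.conj_ofReal,
        Complex.conj_I]
      match_scalars <;> ring_nf
      simp
    have h3 : ‖b + (t * Complex.I) • (1 : B)‖ ^ 2 ≤ ‖b‖ ^ 2 + t ^ 2 := by
      rw [sq, ← CStarRing.norm_star_mul_self, h2]
      refine (norm_add_le _ _).trans (add_le_add ((norm_mul_le _ _).trans_eq (sq _).symm) ?_)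
      have hone : ‖(1 : B)‖ ≤ 1 := by
        nontriviality B
        exact CStarRing.norm_one.le
      rw [norm_smul, norm_pow, Complex.norm_real, Real.norm_eq_abs, sq_abs]
      exact mul_le_of_le_one_right (sq_nonneg t) hone
    have h4 : ‖f (b + (t * Complex.I) • (1 : B))‖ ≤ ‖b + (t * Complex.I) • (1 : B)‖ :=
      f.le_of_opNorm_le hf _ |>.trans_eq (one_mul _)
    have h5 : |(f b).im + t| ≤ ‖f (b + (t * Complex.I) • (1 : B))‖ := by
      refine (Complex.abs_im_le_norm _).trans_eq' ?_
      simp [h1]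
    rw [← sq_abs]
    exact (pow_le_pow_left₀ (abs_nonneg _) (h5.trans h4) 2).trans h3
  by_contra him
  -- For this `t` the inequality reads `(Im (f b)) ^ 2 + 2 ‖b‖ ^ 2 ≤ ‖b‖ ^ 2`.
  have := key (‖b‖ ^ 2 / (f b).im)
  have e : (f b).im * (‖b‖ ^ 2 / (f b).im) = ‖b‖ ^ 2 := by field_simp
  have hpos : 0 < (f b).im ^ 2 := by positivity
  nlinarith [sq_nonneg ‖b‖]

variable [PartialOrder B] [StarOrderedRing B]

/-- A functional of norm at most one with `f 1 = 1` is positive: for `b ≥ 0` the bound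
`‖‖b‖ - b‖ ≤ ‖b‖` gives `|‖b‖ - f b| ≤ ‖b‖`. -/
theorem apply_nonneg_of_norm_le_one {f : StrongDual ℂ B} (hf : ‖f‖ ≤ 1) (h1 : f 1 = 1)
    {b : B} (hb : 0 ≤ b) : 0 ≤ f b := by
  have him := im_apply_eq_zero_of_norm_le_one hf h1 (IsSelfAdjoint.of_nonneg hb)
  have hle : ‖(‖b‖ : ℂ) • (1 : B) - b‖ ≤ ‖b‖ := by
    have e : (‖b‖ : ℂ) • (1 : B) = algebraMap ℝ B ‖b‖ := by
      rw [Algebra.algebraMap_eq_smul_one, Complex.coe_smul]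
    have h0 : 0 ≤ algebraMap ℝ B ‖b‖ - b :=
      sub_nonneg.2 (IsSelfAdjoint.of_nonneg hb).le_algebraMap_norm_self
    rw [e, norm_le_iff_le_algebraMap _ (norm_nonneg b) h0]
    exact sub_le_self _ hb
  have h2 : ‖(‖b‖ : ℂ) - f b‖ ≤ ‖b‖ := by
    have := (f.le_of_opNorm_le hf ((‖b‖ : ℂ) • (1 : B) - b)).trans_eq (one_mul _)
    rw [map_sub, map_smul, h1, smul_eq_mul, mul_one] at this
    exact this.trans hle
  have h3 := (Complex.re_le_norm _).trans h2
  rw [Complex.sub_re, Complex.ofReal_re] at h3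
  exact Complex.nonneg_iff.2 ⟨by linarith, him.symm⟩

theorem norm_one_add_of_nonneg [Nontrivial B] {a : B} (ha : 0 ≤ a) : ‖1 + a‖ = 1 + ‖a‖ := by
  refine le_antisymm ((norm_add_le _ _).trans_eq (by rw [CStarRing.norm_one])) ?_
  have h := norm_mem_spectrum_of_nonneg ha
  have h' : 1 + ‖a‖ ∈ spectrum ℝ (algebraMap ℝ B 1 + a) := by
    rw [add_comm 1 ‖a‖]
    exact spectrum.add_mem_add_iff.2 h
  rw [map_one] at h'
  have := spectrum.norm_le_norm_of_mem h'
  rwa [Real.norm_of_nonneg (by positivity)] at this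

theorem exists_state_apply_eq_norm [Nontrivial B] {a : B} (ha : 0 ≤ a) :
    ∃ f : B →ₚ[ℂ] ℂ, f 1 = 1 ∧ f a = ‖a‖ := by
  -- As `g (1 + a) = 1 + ‖a‖` while `|g 1| ≤ 1` and `|g a| ≤ ‖a‖`, both bounds are attained.
  obtain ⟨g, hg, hga⟩ := exists_dual_vector'' ℂ (1 + a)
  rw [norm_one_add_of_nonneg ha, map_add] at hga
  have hg1 : ‖g 1‖ ≤ 1 :=
    (g.le_of_opNorm_le hg 1).trans_eq (by rw [one_mul, CStarRing.norm_one])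
  have hg2 : ‖g a‖ ≤ ‖a‖ := (g.le_of_opNorm_le hg a).trans_eq (one_mul _)
  have hre : (g 1).re + (g a).re = 1 + ‖a‖ := by simpa using congrArg Complex.re hga
  have r1 := Complex.re_le_norm (g 1)
  have r2 := Complex.re_le_norm (g a)
  have hn : (g 1).re = ‖g 1‖ := by linarith
  have e1 : g 1 = 1 := by
    rw [Complex.eq_coe_norm_of_nonneg (Complex.re_eq_norm.1 hn), ← hn]
    exact_mod_cast (by linarith : (g 1).re = 1)
  refine ⟨PositiveLinearMap.mk₀ (g : B →ₗ[ℂ] ℂ)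
    fun b hb => apply_nonneg_of_norm_le_one hg e1 hb, e1, ?_⟩
  change g a = ‖a‖
  rw [e1] at hga
  push_cast at hga
  exact add_left_cancel hga

end CStarAlgebra

/-! ### Direct sums of representations -/

namespace lp

variable {ι : Type*} {G : ι → Type*} [∀ i, NormedAddCommGroup (G i)]
  [∀ i, InnerProductSpace ℂ (G i)]

/-- The operator on an `ℓ²`-sum that acts on the `i`-th summand by `T i`, for a family of
operators with a common bound `C` for their norms. Over an empty index set `C` may be negative,
whence the bound `|C|` for the norm of the operator. -/
noncomputable def diagonal (T : ∀ i, G i →L[ℂ] G i) {C : ℝ} (hT : ∀ i, ‖T i‖ ≤ C) :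
    lp G 2 →L[ℂ] lp G 2 :=
  have hle (x : lp G 2) (i : ι) : ‖T i (x i)‖ ≤ ‖(C • lp.toNorm x) i‖ := by
    have hC : 0 ≤ C := (norm_nonneg (T i)).trans (hT i)
    refine ((T i).le_of_opNorm_le (hT i) (x i)).trans_eq ?_
    simp [abs_of_nonneg hC]
  LinearMap.mkContinuous
    { toFun := fun x => ⟨fun i => T i (x i), (lp.memℓp (C • lp.toNorm x)).mono' (hle x)⟩
      map_add' := fun x y => lp.ext <| funext fun i => map_add (T i) (x i) (y i)
      map_smul' := fun c x => lp.ext <| funext fun i => map_smul (T i) c (x i) } |C| fun x => by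
    refine (lp.norm_mono (y := C • lp.toNorm x) two_ne_zero (hle x)).trans_eq ?_
    rw [norm_smul, lp.norm_toNorm, Real.norm_eq_abs]

@[simp]
theorem diagonal_apply (T : ∀ i, G i →L[ℂ] G i) {C : ℝ} (hT : ∀ i, ‖T i‖ ≤ C) (x : lp G 2)
    (i : ι) : diagonal T hT x i = T i (x i) := rfl

theorem norm_le_norm_diagonal (T : ∀ i, G i →L[ℂ] G i) {C : ℝ} (hT : ∀ i, ‖T i‖ ≤ C) (i : ι) :
    ‖T i‖ ≤ ‖diagonal T hT‖ := by
  classical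
  refine (T i).opNorm_le_bound (ContinuousLinearMap.opNorm_nonneg _) fun x => ?_
  calc ‖T i x‖ = ‖diagonal T hT (lp.single 2 i x) i‖ := by simp
    _ ≤ ‖diagonal T hT (lp.single 2 i x)‖ := lp.norm_apply_le_norm two_ne_zero _ i
    _ ≤ ‖diagonal T hT‖ * ‖lp.single 2 i x‖ := ContinuousLinearMap.le_opNorm _ _
    _ = ‖diagonal T hT‖ * ‖x‖ := by rw [lp.norm_single two_pos]

/-- The direct sum of a family of representations of a C⋆-algebra on Hilbert spaces. -/
noncomputable def directSumRep {B : Type*} [CStarAlgebra B] [∀ i, CompleteSpace (G i)]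
    (π : ∀ i, B →⋆ₐ[ℂ] (G i →L[ℂ] G i)) : B →⋆ₐ[ℂ] (lp G 2 →L[ℂ] lp G 2) where
  toFun b := diagonal (fun i => π i b) fun i => NonUnitalStarAlgHom.norm_apply_le (π i) b
  map_one' := by ext x i; simp
  map_mul' a b := by ext x i; simp
  map_zero' := by ext x i; simp
  map_add' a b := by ext x i; simp
  commutes' c := by ext x i; simp [Algebra.algebraMap_eq_smul_one]
  map_star' b := by
    rw [ContinuousLinearMap.star_eq_adjoint, ContinuousLinearMap.eq_adjoint_iff]
    intro x y
    simp only [lp.inner_eq_tsum, diagonal_apply, map_star, ContinuousLinearMap.star_eq_adjoint,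
      ContinuousLinearMap.adjoint_inner_left]

end lp

/-! ### The Gelfand–Naimark theorem -/

namespace CStarAlgebra

variable {B : Type u} [CStarAlgebra B]

/-- The class of `1` is a unit vector of the GNS space, which `b` maps to the class of `b`, a vector
of norm `f (b^* b) ^ (1 / 2) = ‖b‖`. -/
theorem norm_le_norm_gnsStarAlgHom [PartialOrder B] [StarOrderedRing B] {f : B →ₚ[ℂ] ℂ} {b : B}
    (h1 : f 1 = 1) (hb : f (star b * b) = ‖star b * b‖) : ‖b‖ ≤ ‖f.gnsStarAlgHom b‖ := by
  have hn (a : B) : ((‖(f.toPreGNS a : f.GNS)‖ ^ 2 : ℝ) : ℂ) = f (star a * a) := by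
    rw [UniformSpace.Completion.norm_coe]
    push_cast
    exact f.preGNS_norm_sq (f.toPreGNS a)
  have n1 : ‖(f.toPreGNS 1 : f.GNS)‖ = 1 := by
    have := hn 1
    rw [star_one, one_mul, h1] at this
    exact (pow_eq_one_iff_of_nonneg (norm_nonneg _) two_ne_zero).1 (by exact_mod_cast this)
  have n2 : ‖(f.toPreGNS b : f.GNS)‖ = ‖b‖ := by
    have := hn b
    rw [hb, CStarRing.norm_star_mul_self, ← sq] at this
    exact (pow_left_inj₀ (norm_nonneg _) (norm_nonneg _) two_ne_zero).1 (by exact_mod_cast this)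
  have := (f.gnsStarAlgHom b).le_opNorm (f.toPreGNS 1 : f.GNS)
  rw [n1, mul_one] at this
  refine n2.symm.trans_le (this.trans_eq' ?_)
  simp

variable (B) in
/-- Every nontrivial unital C⋆-algebra has an isometric unital representation on a
Hilbert space in the same universe. -/
theorem exists_isometric_representation [Nontrivial B] :
    ∃ (H : Type u) (_ : NormedAddCommGroup H) (_ : InnerProductSpace ℂ H) (_ : CompleteSpace H)
      (π : B →⋆ₐ[ℂ] (H →L[ℂ] H)), ∀ b, ‖π b‖ = ‖b‖ := by
  let _ := spectralOrder B
  have := spectralOrderedRing B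
  choose f hf1 hf using fun b : B => exists_state_apply_eq_norm (star_mul_self_nonneg b)
  refine ⟨lp (fun b => (f b).GNS) 2, inferInstance, inferInstance, inferInstance,
    lp.directSumRep fun b => (f b).gnsStarAlgHom, fun b =>
      le_antisymm (NonUnitalStarAlgHom.norm_apply_le _ b) ?_⟩
  exact (norm_le_norm_gnsStarAlgHom (hf1 b) (hf b)).trans
    (lp.norm_le_norm_diagonal (fun i => (f i).gnsStarAlgHom b)
      (fun i => NonUnitalStarAlgHom.norm_apply_le (f i).gnsStarAlgHom b) b)

end CStarAlgebra

end GelfandNaimark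

/-! ### Isometric images of Colombeau C⋆-subalgebras -/

namespace Colombeau

theorem IsColombeauCStarAlgebra.of_isometric {A A' : Type*} [NormedRing A] [StarRing A]
    [Algebra GenComplex A] [NormedRing A'] [StarRing A'] [Algebra GenComplex A']
    (hA : IsColombeauCStarAlgebra A) (φ : A ≃⋆ₐ[GenComplex] A') (hφ : ∀ u, ‖φ u‖ = ‖u‖) :
    IsColombeauCStarAlgebra A' := by
  have hiso : Isometry φ := AddMonoidHomClass.isometry_of_norm φ hφ
  have hsurj : Function.Surjective φ := EquivLike.surjective φ
  constructor
  · intro u v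
    obtain ⟨u, rfl⟩ := hsurj u
    obtain ⟨v, rfl⟩ := hsurj v
    rw [← map_add, hφ, hφ, hφ]
    exact hA.norm_add_le_max u v
  · intro z u
    obtain ⟨u, rfl⟩ := hsurj u
    rw [← map_smul, hφ, hφ]
    exact hA.norm_smul_le z u
  · rw [← map_one φ, hφ, hA.norm_one]
  · intro z u
    obtain ⟨u, rfl⟩ := hsurj u
    rw [← map_smul, ← map_star, ← map_star, ← map_smul, hA.star_smul]
  · intro u
    obtain ⟨u, rfl⟩ := hsurj u
    rw [← map_star, ← map_mul, hφ, hφ, hA.norm_star_mul_self]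
  · have := hA.complete
    exact (IsometryEquiv.mk φ.toEquiv hiso).completeSpace_iff.1 inferInstance

theorem exists_isomorphic_starSubalgebra {X Y : Type*} [NormedRing X] [StarRing X]
    [Algebra GenComplex X] [StarModule GenComplex X] [NormedRing Y] [StarRing Y]
    [Algebra GenComplex Y] [StarModule GenComplex Y] {A : StarSubalgebra GenComplex X}
    (hA : IsColombeauCStarSubalgebra A) (φ : X →⋆ₐ[GenComplex] Y) (hφ : ∀ u, ‖φ u‖ = ‖u‖) :
    ∃ A' : StarSubalgebra GenComplex Y, IsColombeauCStarSubalgebra A' ∧ Isomorphic A A' := by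
  have hinj : Function.Injective (φ.comp A.subtype) :=
    (AddMonoidHomClass.isometry_of_norm φ hφ).injective.comp Subtype.val_injective
  have hnorm (u : A) : ‖StarAlgEquiv.ofInjective _ hinj u‖ = ‖u‖ := hφ u
  exact ⟨_, hA.of_isometric _ hnorm, StarAlgEquiv.ofInjective _ hinj, hnorm⟩

/-! ### Maps between Colombeau spaces induced by representations -/

/-- The ultra-pseudo-norm is insensitive to constant factors. -/
theorem norm_mk_le_of_norm_le {E F : Type*} [NormedAddCommGroup E] [NormedAddCommGroup F]
    {u : moderateNets E} {v : moderateNets F} {C : ℝ} (h : ∀ ε, ‖u.1 ε‖ ≤ C * ‖v.1 ε‖) :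
    ‖mk u‖ ≤ ‖mk v‖ := by
  refine le_of_forall_gt_imp_ge_of_dense fun a ha => ?_
  have ha0 : 0 < a := (norm_nonneg _).trans_lt ha
  obtain ⟨r, rfl⟩ : ∃ r, a = Real.exp (-r) := ⟨-Real.log a, by rw [neg_neg, Real.exp_log ha0]⟩
  refine pseudoNorm_mk_le_exp_iff.2 fun b hb => ?_
  obtain ⟨c, hbc, hcr⟩ := exists_between hb
  filter_upwards [pseudoNorm_mk_le_exp_iff.1 ha.le c hcr, small_const_mul |C| hbc] with ε h1 h2
  calc ‖u.1 ε‖ ≤ |C| * ‖v.1 ε‖ :=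
        (h ε).trans (mul_le_mul_of_nonneg_right (le_abs_self C) (norm_nonneg _))
    _ ≤ |C| * (ε : ℝ) ^ c := mul_le_mul_of_nonneg_left h1 (abs_nonneg C)
    _ ≤ (ε : ℝ) ^ b := h2

section Map

variable {B D : Type*} [CStarAlgebra B] [CStarAlgebra D]

theorem comp_mem_moderateNets (π : B →⋆ₐ[ℂ] D) (u : moderateNets B) :
    (fun ε => π (u.1 ε)) ∈ moderateNets D := by
  obtain ⟨b, hb⟩ := mem_moderateNets.1 u.2
  exact mem_moderateNets.2 ⟨b, hb.of_norm_le fun ε => NonUnitalStarAlgHom.norm_apply_le π _⟩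

/-- The `⋆`-homomorphism `[(u_ε)_ε] ↦ [(π u_ε)_ε]` induced by a `⋆`-homomorphism `π` of
C⋆-algebras. -/
noncomputable def Space.map (π : B →⋆ₐ[ℂ] D) : Space B →⋆ₐ[GenComplex] Space D where
  toFun := Quotient.lift (fun u => mk ⟨_, comp_mem_moderateNets π u⟩) (by
    intro u v h
    have h' := mk_eq_mk.1 (Quotient.sound h : mk u = mk v)
    rw [mk_eq_mk]
    intro m
    refine (h' m).of_norm_le fun ε => ?_
    change ‖-π (u.1 ε) + π (v.1 ε)‖ ≤ ‖-u.1 ε + v.1 ε‖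
    rw [← map_neg, ← map_add]
    exact NonUnitalStarAlgHom.norm_apply_le π _)
  map_one' := mk_congr fun ε => map_one π
  map_mul' := by
    rintro ⟨u⟩ ⟨v⟩
    exact mk_congr fun ε => map_mul π _ _
  map_zero' := mk_congr fun ε => map_zero π
  map_add' := by
    rintro ⟨u⟩ ⟨v⟩
    exact mk_congr fun ε => map_add π _ _
  commutes' := by
    rintro ⟨z⟩
    exact mk_congr fun ε => (map_smul π _ _).trans (congrArg _ (map_one π))
  map_star' := by
    rintro ⟨u⟩
    exact mk_congr fun ε => map_star π _

theorem Space.norm_map {π : B →⋆ₐ[ℂ] D} (hπ : ∀ b, ‖π b‖ = ‖b‖) (x : Space B) :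
    ‖Space.map π x‖ = ‖x‖ := by
  obtain ⟨u, rfl⟩ := mk_surj x
  exact le_antisymm
    (norm_mk_le_of_norm_le (C := 1) fun ε => by rw [one_mul]; exact (hπ _).le)
    (norm_mk_le_of_norm_le (C := 1) fun ε => by rw [one_mul]; exact (hπ _).ge)

end Map

/-! ### Nets of operators acting on nets of vectors -/

section Operators

variable {H : Type*} [NormedAddCommGroup H] [InnerProductSpace ℂ H]

/-- The evaluation `([(T_ε)_ε], [(u_ε)_ε]) ↦ [(T_ε u_ε)_ε]`. -/
noncomputable def Space.apply : Space (H →L[ℂ] H) → Space H → Space H :=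
  map₂ (fun T x => T x) (fun _ _ _ => rfl) (fun T _ _ => map_add T _ _)
    ContinuousLinearMap.le_opNorm

theorem Space.norm_apply_le (T : Space (H →L[ℂ] H)) (u : Space H) :
    ‖Space.apply T u‖ ≤ ‖T‖ * ‖u‖ :=
  pseudoNorm_map₂_le _ _ _ _ T u

/-- A class of nets of operators as a continuous operator on `𝒢_H`. -/
noncomputable def Space.toCLM (T : Space (H →L[ℂ] H)) : Space H →L[GenComplex] Space H where
  toFun := Space.apply T
  map_add' := by
    obtain ⟨T, rfl⟩ := mk_surj T
    rintro ⟨u⟩ ⟨v⟩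
    exact mk_congr fun ε => map_add _ _ _
  map_smul' := by
    obtain ⟨T, rfl⟩ := mk_surj T
    rintro ⟨z⟩ ⟨u⟩
    exact mk_congr fun ε => map_smul _ _ _
  cont := by
    have hadd : ∀ u v, Space.apply T (u + v) = Space.apply T u + Space.apply T v := by
      obtain ⟨T, rfl⟩ := mk_surj T
      rintro ⟨u⟩ ⟨v⟩
      exact mk_congr fun ε => map_add _ _ _
    exact AddMonoidHomClass.continuous_of_bound (AddMonoidHom.mk' (Space.apply T) hadd) ‖T‖
      (Space.norm_apply_le T)

variable [CompleteSpace H]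

theorem Space.isAdjoint_toCLM_star (T : Space (H →L[ℂ] H)) :
    IsAdjoint (Space.toCLM T) (Space.toCLM (star T)) := by
  obtain ⟨T, rfl⟩ := mk_surj T
  rintro ⟨u⟩ ⟨v⟩
  exact mk_congr fun ε => (ContinuousLinearMap.adjoint_inner_right (T.1 ε) _ _).symm

/-- A class of nets of operators as an element of `ℬ(𝒢_H)`. -/
noncomputable def BoundedOp.ofSpace (T : Space (H →L[ℂ] H)) : BoundedOp H :=
  (⟨Space.toCLM T, Space.toCLM (star T), Space.isAdjoint_toCLM_star T⟩ : adjointable H)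

variable (H) in
/-- The `⋆`-homomorphism `𝒢_{L(H)} → ℬ(𝒢_H)` by which classes of nets of operators act on
`𝒢_H`. -/
noncomputable def Space.toBoundedOp : Space (H →L[ℂ] H) →⋆ₐ[GenComplex] BoundedOp H where
  toFun := BoundedOp.ofSpace
  map_one' := BoundedOp.ext <| ContinuousLinearMap.ext <| by
    rintro ⟨u⟩
    exact mk_congr fun ε => rfl
  map_mul' := by
    rintro ⟨T⟩ ⟨S⟩
    refine BoundedOp.ext <| ContinuousLinearMap.ext ?_
    rintro ⟨u⟩
    exact mk_congr fun ε => rfl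
  map_zero' := BoundedOp.ext <| ContinuousLinearMap.ext <| by
    rintro ⟨u⟩
    exact mk_congr fun ε => rfl
  map_add' := by
    rintro ⟨T⟩ ⟨S⟩
    refine BoundedOp.ext <| ContinuousLinearMap.ext ?_
    rintro ⟨u⟩
    exact mk_congr fun ε => rfl
  commutes' := by
    rintro ⟨z⟩
    refine BoundedOp.ext <| ContinuousLinearMap.ext ?_
    rintro ⟨u⟩
    exact mk_congr fun ε => rfl
  map_star' T := (BoundedOp.star_eq (T := BoundedOp.ofSpace T) (S := BoundedOp.ofSpace (star T))
    (Space.isAdjoint_toCLM_star T)).symm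

theorem Space.norm_toBoundedOp (T : Space (H →L[ℂ] H)) : ‖Space.toBoundedOp H T‖ = ‖T‖ := by
  refine le_antisymm (opNorm_le (norm_nonneg T) (Space.norm_apply_le T)) ?_
  obtain ⟨T, rfl⟩ := mk_surj T
  have hex (S : H →L[ℂ] H) : ∃ x : H, ‖x‖ ≤ 1 ∧ ‖S‖ ≤ 2 * ‖S x‖ := by
    rcases eq_or_ne S 0 with rfl | hS
    · exact ⟨0, by simp, by simp⟩
    · have hpos := norm_pos_iff.2 hS
      obtain ⟨x, hx, hSx⟩ := S.exists_lt_apply_of_lt_opNorm (half_lt_self hpos)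
      exact ⟨x, hx.le, by linarith⟩
  choose x hx hTx using fun ε => hex (T.1 ε)
  have hord : OrderGE x 0 := Eventually.of_forall fun ε => by simpa using hx ε
  let u : moderateNets H := ⟨x, mem_moderateNets.2 ⟨0, hord⟩⟩
  have hu : ‖mk u‖ ≤ 1 := by
    have := pseudoNorm_mk_le_exp_iff (u := u) (r := 0) |>.2 fun b hb => hord.anti hb.le
    rwa [neg_zero, Real.exp_zero] at this
  calc ‖mk T‖ ≤ ‖Space.apply (mk T) (mk u)‖ := norm_mk_le_of_norm_le hTx
    _ ≤ ‖Space.toBoundedOp H (mk T)‖ * ‖mk u‖ :=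
        le_opNorm (Space.toBoundedOp H (mk T)).toCLM (mk u)
    _ ≤ ‖Space.toBoundedOp H (mk T)‖ := mul_le_of_le_one_right (norm_nonneg _) hu

end Operators

/-- The zero algebra is excluded by the axiom `‖1‖ = 1`. -/
theorem IsColombeauCStarSubalgebra.nontrivial {B : Type*} [CStarAlgebra B]
    {A : StarSubalgebra GenComplex (Space B)} (hA : IsColombeauCStarSubalgebra A) :
    Nontrivial B := by
  by_contra h
  rw [not_nontrivial_iff_subsingleton] at h
  have h0 : (1 : A) = 0 := Subtype.ext (mk_congr fun ε => Subsingleton.elim _ _)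
  have := hA.norm_one
  rw [h0, norm_zero] at this
  exact zero_ne_one this

end Colombeau

theorem mainTheorem6 {B : Type u} [CStarAlgebra B]
    (A : StarSubalgebra Colombeau.GenComplex (Colombeau.Space B))
    (hA : Colombeau.IsColombeauCStarSubalgebra A) :
    ∃ (H : Type u) (_ : NormedAddCommGroup H) (_ : InnerProductSpace ℂ H) (_ : CompleteSpace H),
      (∃ A' : StarSubalgebra Colombeau.GenComplex (Colombeau.Space (H →L[ℂ] H)),
        Colombeau.IsColombeauCStarSubalgebra A' ∧ Colombeau.Isomorphic A A') ∧
      (∃ A'' : StarSubalgebra Colombeau.GenComplex (Colombeau.BoundedOp H),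
        Colombeau.IsColombeauCStarSubalgebra A'' ∧ Colombeau.Isomorphic A A'') := by
  have := hA.nontrivial
  obtain ⟨H, _, _, _, π, hπ⟩ := CStarAlgebra.exists_isometric_representation B
  refine ⟨H, inferInstance, inferInstance, inferInstance,
    Colombeau.exists_isomorphic_starSubalgebra hA (Colombeau.Space.map π)
      (Colombeau.Space.norm_map hπ),
    Colombeau.exists_isomorphic_starSubalgebra hA
      ((Colombeau.Space.toBoundedOp H).comp (Colombeau.Space.map π)) fun u => ?_⟩
  exact (Colombeau.Space.norm_toBoundedOp _).trans (Colombeau.Space.norm_map hπ u)
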